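/- **Theorem.** Let $k$ be an algebraically closed field and let $A=\bigoplus_{n\ge 0}A_n$ be a finitely generated (commutative) graded $k$-algebra with $A_0=k$ (not necessarily standard graded). Assume that $A$ is Cohen–Macaulay and that $\dim A=d\ge 2$. Assume further: 1. There is a Noether normalization $T=k[X_1,\dots,X_d]$ of $A$ with $X_1,\dots,X_d$ homogeneous of the same degree $m$; that is, $X_1,\dots,X_d\in A_m$ are algebraically independent over $k$ and $A$ is a finite module over $T$. 2. For every $T$-regular sequence $u_1,\dots,u_{d-1}\in T_m$ the $A$-module $A/(u_1,\dots,u_{d-1})A$ has exactly one associated prime ideal of height $d-1$ (height taken in $A$). Let $R$ be a graded ring with inclusions of graded rings $T\subseteq R\subseteq A$ and $\operatorname{grade}(T_+,R)\ge d-1$, where $T_+$ is the ideal of $T$ generated by the homogeneous elements of positive degree and $\operatorname{grade}(T_+,R)$ is the supremum of the lengths of $R$-regular sequences in $T_+$. Then the first graded Chow group $A_1^*(R)$ is a torsion group. Here, for $i\ge 0$, the graded Chow group $A_i^*(R)$ is defined as follows. Let $Z_i^*(R)$ be the free abelian group on the symbols $[R/P]$ with $P$ a homogeneous prime ideal of $R$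 such that $\dim R/P=i$. For a homogeneous prime ideal $Q$ of $R$ with $\dim R/Q=i+1$ and a homogeneous element $x\in R\setminus Q$ put $$\operatorname{div}(Q,x)=\sum_{P}\operatorname{length}_{R_P}\bigl(((R/Q)/x(R/Q))_P\bigr)\,[R/P]\in Z_i^*(R),$$ the sum being over the homogeneous primes $P$ of $R$ with $\dim R/P=i$. Then $A_i^*(R)$ is the quotient of $Z_i^*(R)$ by the subgroup generated by all these elements $\operatorname{div}(Q,x)$. -/

import Mathlib

namespace GradedChow

/-! ### Graded Chow groups -/

section ChowGroup

variable {ι σ R : Type*} [DecidableEq ι] [AddMonoid ι] [CommRing R] [SetLike σ R]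
  [AddSubgroupClass σ R] (ℛ : ι → σ) [GradedRing ℛ]

/-- The homogeneous prime ideals `P` of the graded ring `R` with `dim R/P = i`. -/
def HomogeneousPrime (i : ℕ) : Type _ :=
  {P : Ideal R // P.IsPrime ∧ P.IsHomogeneous ℛ ∧ ringKrullDim (R ⧸ P) = (i : WithBot ℕ∞)}

instance (i : ℕ) (P : HomogeneousPrime ℛ i) : P.1.IsPrime := P.2.1

/-- `Z_i^*(R)`: the free abelian group on the homogeneous primes `P` with `dim R/P = i`. -/
abbrev GradedCycles (i : ℕ) : Type _ := HomogeneousPrime ℛ i →₀ ℤ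

/-- The length of the `R_P`-module `M_P`. -/
noncomputable def localLength (P : Ideal R) [P.IsPrime] (M : Type*) [AddCommGroup M]
    [Module R M] : ℕ∞ :=
  Module.length (Localization.AtPrime P) (LocalizedModule P.primeCompl M)

open Classical in
/-- The cycle `[M]_i = ∑ length(M_P) [R/P]`, the sum being over the homogeneous primes `P` of `R`
with `dim R/P = i`. (The sum is finite for the modules for which it is used below, see
`div_apply`, and for these every `length(M_P)` is finite when `R` is Noetherian, since `P` is then
minimal in the support of `M` or outside it; by convention the cycle is zero if the sum is
infinite.) -/
noncomputable def cycle (i : ℕ) (M : Type*) [AddCommGroup M] [Module R M] : GradedCycles ℛ i :=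
  if h : (Function.support
      fun P : HomogeneousPrime ℛ i => ((localLength P.1 M).toNat : ℤ)).Finite then
    Finsupp.ofSupportFinite _ h
  else 0

/-- `div(Q, x) = [(R/Q)/x(R/Q)]_i` for a homogeneous prime `Q` with `dim R/Q = i + 1`. -/
noncomputable def div {i : ℕ} (Q : HomogeneousPrime ℛ (i + 1)) (x : R) : GradedCycles ℛ i :=
  cycle ℛ i (QuotSMulTop x (R ⧸ Q.1))

/-- The cycles that are gradedly rationally equivalent to zero: the subgroup generated by all
`div(Q, x)` with `Q` a homogeneous prime, `dim R/Q = i + 1`, and `x ∉ Q` homogeneous. -/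
noncomputable def rationallyTrivial (i : ℕ) : AddSubgroup (GradedCycles ℛ i) :=
  AddSubgroup.closure
    {z | ∃ (Q : HomogeneousPrime ℛ (i + 1)) (x : R),
      SetLike.IsHomogeneousElem ℛ x ∧ x ∉ Q.1 ∧ z = div ℛ Q x}

/-- The graded Chow group `A_i^*(R)`. -/
abbrev GradedChowGroup (i : ℕ) : Type _ := GradedCycles ℛ i ⧸ rationallyTrivial ℛ i

theorem div_support_finite [IsNoetherianRing R] {i : ℕ} (Q : HomogeneousPrime ℛ (i + 1)) (x : R)
    (hx : x ∉ Q.1) :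
    (Function.support fun P : HomogeneousPrime ℛ i =>
      ((localLength P.1 (QuotSMulTop x (R ⧸ Q.1))).toNat : ℤ)).Finite := by
  have key : ∀ P P' : Ideal R, P.IsPrime → P'.IsPrime → P < P' →
      ringKrullDim (R ⧸ P') + 1 ≤ ringKrullDim (R ⧸ P) := by
    intro P P' hP hP' h
    obtain ⟨y, hy', hy⟩ := Set.exists_of_ssubset h
    refine ringKrullDim_succ_le_of_surjective (Ideal.Quotient.factor h.le)
      (Ideal.Quotient.factor_surjective h.le) (r := Ideal.Quotient.mk P y) ?_ ?_
    · exact mem_nonZeroDivisors_of_ne_zero (by rwa [Ne, Ideal.Quotient.eq_zero_iff_mem])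
    · simpa [Ideal.Quotient.eq_zero_iff_mem] using hy'
  have hsub : ∀ P : HomogeneousPrime ℛ i,
      ((localLength P.1 (QuotSMulTop x (R ⧸ Q.1))).toNat : ℤ) ≠ 0 →
      P.1 ∈ (Q.1 ⊔ Ideal.span {x}).minimalPrimes := by
    intro P hP
    have hnt : Nontrivial (LocalizedModule P.1.primeCompl (QuotSMulTop x (R ⧸ Q.1))) := by
      by_contra hn
      rw [not_nontrivial_iff_subsingleton] at hn
      apply hP
      simp [localLength, Module.length_eq_zero]
    have hsupp : (⟨P.1, P.2.1⟩ : PrimeSpectrum R) ∈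
        Module.support R (QuotSMulTop x (R ⧸ Q.1)) := hnt
    have hann : Module.annihilator R (QuotSMulTop x (R ⧸ Q.1)) ≤ P.1 :=
      Module.annihilator_le_of_mem_support hsupp
    have hle : Q.1 ⊔ Ideal.span {x} ≤ P.1 := by
      refine le_trans (sup_le ?_ ?_) hann
      · intro q hq
        rw [Module.mem_annihilator]
        intro z
        obtain ⟨z, rfl⟩ := Submodule.Quotient.mk_surjective _ z
        obtain ⟨z, rfl⟩ := Ideal.Quotient.mk_surjective z
        have h0 : q • (Ideal.Quotient.mk Q.1 z) = 0 := by
          rw [Algebra.smul_def, Ideal.Quotient.algebraMap_eq, ← map_mul,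
            Ideal.Quotient.eq_zero_iff_mem]
          exact Q.1.mul_mem_right _ hq
        rw [← Submodule.Quotient.mk_smul, h0, Submodule.Quotient.mk_zero]
      · rw [Ideal.span_singleton_le_iff_mem, Module.mem_annihilator]
        intro z
        obtain ⟨z, rfl⟩ := Submodule.Quotient.mk_surjective _ z
        rw [← Submodule.Quotient.mk_smul, Submodule.Quotient.mk_eq_zero]
        exact Submodule.smul_mem_pointwise_smul _ _ _ trivial
    refine ⟨⟨P.2.1, hle⟩, ?_⟩
    rintro P' ⟨hP', hle'⟩ hP'P
    by_contra hn
    have h1 : P' < P.1 := lt_of_le_not_ge hP'P hn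
    have h2 : Q.1 < P' := by
      refine lt_of_le_of_ne (le_sup_left.trans hle') ?_
      rintro h
      exact hx (h ▸ hle' ((le_sup_right : Ideal.span {x} ≤ _) (Ideal.mem_span_singleton_self x)))
    have h3 := key _ _ hP' P.2.1 h1
    have h4 := key _ _ Q.2.1 hP' h2
    rw [P.2.2.2] at h3
    rw [Q.2.2.2] at h4
    have h5 : ((i : WithBot ℕ∞) + 1) + 1 ≤ ((i + 1 : ℕ) : WithBot ℕ∞) :=
      le_trans (by gcongr) h4
    have h6 : i + 1 + 1 ≤ i + 1 := by exact_mod_cast h5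
    omega
  refine Set.Finite.subset
    (((Q.1 ⊔ Ideal.span {x}).finite_minimalPrimes_of_isNoetherianRing).preimage
      (f := fun P : HomogeneousPrime ℛ i => P.1) (Subtype.val_injective.injOn)) ?_
  intro P hP
  exact hsub P hP

theorem div_apply [IsNoetherianRing R] {i : ℕ} (Q : HomogeneousPrime ℛ (i + 1)) (x : R)
    (hx : x ∉ Q.1) (P : HomogeneousPrime ℛ i) :
    div ℛ Q x P = ((localLength P.1 (QuotSMulTop x (R ⧸ Q.1))).toNat : ℤ) := by
  rw [div, cycle, dif_pos (div_support_finite ℛ Q x hx)]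
  rfl

end ChowGroup

/-! ### Cohen-Macaulay rings, grade, Noether normalizations -/

/-- A Noetherian ring `A` is Cohen-Macaulay if for every maximal ideal `𝔪` the depth of the local
ring `A_𝔪` is equal to its dimension, that is, there is a regular sequence of length `dim A_𝔪` in
the maximal ideal of `A_𝔪`. -/
def IsCohenMacaulay (A : Type*) [CommRing A] : Prop :=
  IsNoetherianRing A ∧ ∀ (𝔪 : Ideal A) [𝔪.IsMaximal],
    ∃ rs : List (Localization.AtPrime 𝔪),
      (∀ r ∈ rs, r ∈ IsLocalRing.maximalIdeal (Localization.AtPrime 𝔪)) ∧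
      RingTheory.Sequence.IsRegular (Localization.AtPrime 𝔪) rs ∧
      (rs.length : WithBot ℕ∞) = ringKrullDim (Localization.AtPrime 𝔪)

/-- `grade(I, M)`: the supremum of the lengths of the weakly `M`-regular sequences in `I`. For a
finitely generated module over a Noetherian ring this is the common length of the maximal
`M`-regular sequences in `I` if `IM ≠ M`, and `∞` if `IM = M`. -/
noncomputable def grade {T : Type*} [CommRing T] (I : Ideal T) (M : Type*) [AddCommGroup M]
    [Module T M] : ℕ∞ :=
  ⨆ (rs : List T) (_ : ∀ r ∈ rs, r ∈ I) (_ : RingTheory.Sequence.IsWeaklyRegular M rs),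
    (rs.length : ℕ∞)

/-- `Ass_A^{(i)}(M)`: the associated primes of `M` of height `i`. -/
def assOfHeight (A : Type*) [CommRing A] (M : Type*) [AddCommGroup M] [Module A M] (i : ℕ) :
    Set (Ideal A) :=
  {P | P ∈ associatedPrimes A M ∧ P.height = (i : ℕ∞)}

/-- `T = k[X_1, …, X_d]` is a Noether normalization of the graded algebra `A`, with all the `X_i`
homogeneous of degree `m`. -/
structure IsNoetherNormalization {k A : Type*} [Field k] [CommRing A] [Algebra k A]
    (𝒜 : ℕ → Submodule k A) {d : ℕ} (m : ℕ) (X : Fin d → A) (T : Subalgebra k A) : Prop where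
  mem_degree : ∀ i, X i ∈ 𝒜 m
  algebraicIndependent : AlgebraicIndependent k X
  adjoin_eq : Algebra.adjoin k (Set.range X) = T
  finite : Module.Finite T A

/-- The ideal `T_+ = T ∩ A_+` of the graded subring `T` of `A`, where `A_+` is the ideal of
elements with zero component in degree zero. -/
def irrelevant {k A : Type*} [Field k] [CommRing A] [Algebra k A]
    (𝒜 : ℕ → Submodule k A) [GradedAlgebra 𝒜] (T : Subalgebra k A) : Ideal T :=
  (HomogeneousIdeal.irrelevant 𝒜).toIdeal.comap (algebraMap T A)

end GradedChow

/-!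
For a one-dimensional homogeneous prime `P` of `R` a positive multiple of `[R/P]` is the divisor of
one element on a homogeneous prime `Q` with `dim R/Q = 2`; this gives torsion, since the classes
`[R/P]` generate the group (`isAddTorsion_gradedChowGroup`).

Since `k` is algebraically closed, `P ∩ T` is the ideal of a point of projective space. After a
linear change of coordinates it is generated by all coordinates but the last
(`exists_coordinates_of_ringKrullDim_quotient_eq_one`), and these form a `T`-regular sequence in
`T_m`. The uniqueness hypothesis on associated primes then says that exactly one prime of `A`, and
so exactly one prime of `R`, lies over `P ∩ T` (`eq_of_under_comap_eq_flagIdeal`).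

This uses that every prime of `A` over a prime of `T` has the same height as its trace, which is a
consequence of going down for `T ⊆ A`. As `T` is normal, going down holds once all minimal primes
of `A` contract to zero (`hasGoingDown_of_minimalPrimes_under_eq_bot`). They do because `A` is
Cohen-Macaulay: the depth of a local ring is at most the dimension of its quotient by any associated
prime (`length_le_ringKrullDim_quotient_of_mem_associatedPrimes`), so every component of `Spec A`
through the vertex has dimension `d` (`under_eq_bot_of_mem_minimalPrimes`).

Let `q` be the prime of `T` generated by all coordinates of `P ∩ T` except one, say `x`. Going down
provides a homogeneous prime `Q ⊆ P` of `R` over `q`. A one-dimensional homogeneous prime of `R`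
containing `Q` and `x` contains `(P ∩ T)R`, so it lies over `P ∩ T` and equals `P`. Hence the divisor
of `x` on `R/Q` is supported at `P` only, with finite nonzero multiplicity (`div_eq_single`).
-/

namespace GradedChow

/-! ### Dimension and height in integral extensions -/

theorem ringKrullDim_quotient_add_one_le_of_lt {R : Type*} [CommRing R] {P P' : Ideal R}
    [P.IsPrime] (h : P < P') : ringKrullDim (R ⧸ P') + 1 ≤ ringKrullDim (R ⧸ P) := by
  obtain ⟨y, hy', hy⟩ := Set.exists_of_ssubset h
  refine ringKrullDim_succ_le_of_surjective (Ideal.Quotient.factor h.le)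
    (Ideal.Quotient.factor_surjective h.le) (r := Ideal.Quotient.mk P y) ?_ ?_
  · exact mem_nonZeroDivisors_of_ne_zero (by rwa [Ne, Ideal.Quotient.eq_zero_iff_mem])
  · simpa [Ideal.Quotient.eq_zero_iff_mem] using hy'

theorem eq_of_le_of_ringKrullDim_quotient_eq {R : Type*} [CommRing R] {P P' : Ideal R}
    [P.IsPrime] (h : P ≤ P') {i : ℕ} (hP : ringKrullDim (R ⧸ P) = (i : WithBot ℕ∞))
    (hP' : ringKrullDim (R ⧸ P') = (i : WithBot ℕ∞)) : P = P' := by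
  refine h.eq_of_not_lt fun hlt => ?_
  have := ringKrullDim_quotient_add_one_le_of_lt hlt
  rw [hP, hP'] at this
  have : i + 1 ≤ i := by exact_mod_cast this
  omega

theorem ringKrullDim_eq_of_isIntegral (R S : Type*) [CommRing R] [CommRing S] [Algebra R S]
    [FaithfulSMul R S] [Algebra.IsIntegral R S] : ringKrullDim S = ringKrullDim R := by
  refine le_antisymm ?_ ?_
  · refine Order.krullDim_le_of_strictMono (PrimeSpectrum.comap (algebraMap R S)) ?_
    intro P Q h
    exact Ideal.IsIntegral.comap_lt_comap (I := P.asIdeal) (J := Q.asIdeal) h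
  · refine iSup_le fun l => ?_
    obtain ⟨Q, -, hQ, hQl⟩ := Ideal.exists_ideal_over_prime_of_isIntegral
      (RelSeries.head l).asIdeal (⊥ : Ideal S) (by
        rw [← RingHom.ker_eq_comap_bot, (RingHom.injective_iff_ker_eq_bot _).1
          (FaithfulSMul.algebraMap_injective R S)]
        exact bot_le)
    have : Q.LiesOver (RelSeries.head l).asIdeal := ⟨hQl.symm⟩
    obtain ⟨L, hL, -⟩ := Ideal.exists_ltSeries_of_hasGoingUp l Q
    rw [← hL]
    exact Order.LTSeries.length_le_krullDim L

theorem ringKrullDim_quotient_under (R : Type*) {S : Type*} [CommRing R] [CommRing S] [Algebra R S]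
    [Algebra.IsIntegral R S] (P : Ideal S) :
    ringKrullDim (S ⧸ P) = ringKrullDim (R ⧸ P.under R) :=
  ringKrullDim_eq_of_isIntegral _ _

theorem faithfulSMul_quotient_of_under_eq_bot {R S : Type*} [CommRing R] [CommRing S] [Algebra R S]
    {P : Ideal S} (h : P.under R = ⊥) : FaithfulSMul R (S ⧸ P) := by
  rw [faithfulSMul_iff_algebraMap_injective, injective_iff_map_eq_zero]
  intro a ha
  have : a ∈ P.under R := by
    rw [IsScalarTower.algebraMap_apply R S (S ⧸ P)] at ha
    exact (Ideal.Quotient.eq_zero_iff_mem (I := P) (a := algebraMap R S a)).1 ha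
  rwa [h] at this

/-- An integral algebra over a normal domain may have zero divisors and still satisfy going down:
it suffices that every irreducible component dominates the base. -/
theorem hasGoingDown_of_minimalPrimes_under_eq_bot (R S : Type*) [CommRing R] [CommRing S]
    [Algebra R S] [IsDomain R] [IsIntegrallyClosed R] [Algebra.IsIntegral R S]
    (h : ∀ P ∈ minimalPrimes S, P.under R = ⊥) : Algebra.HasGoingDown R S where
  exists_ideal_le_liesOver_of_lt {p} _ Q _ hlt := by
    obtain ⟨P, hP, hPQ⟩ := Ideal.exists_minimalPrimes_le (bot_le : (⊥ : Ideal S) ≤ Q)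
    have hPp : P.IsPrime := hP.1.1
    have := faithfulSMul_quotient_of_under_eq_bot (h P hP)
    have hQ' : (Q.map (Ideal.Quotient.mk P)).IsPrime := Ideal.isPrime_map_quotientMk_of_isPrime hPQ
    have hcomap : (Q.map (Ideal.Quotient.mk P)).comap (Ideal.Quotient.mk P) = Q :=
      Ideal.comap_map_mk hPQ
    have hlo : (Q.map (Ideal.Quotient.mk P)).LiesOver (Q.under R) := by
      constructor
      conv_lhs => rw [← hcomap]
      rfl
    obtain ⟨Q₁, hQ₁, _, hlo₁⟩ := Ideal.exists_ideal_le_liesOver_of_le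
      (Q.map (Ideal.Quotient.mk P)) hlt.le
    refine ⟨Q₁.comap (Ideal.Quotient.mk P), ?_, inferInstance, ⟨hlo₁.over⟩⟩
    exact (Ideal.comap_mono hQ₁).trans_eq hcomap

/-- The fibre term in the dimension formula vanishes, because in an integral extension there are no
inclusions between distinct primes with the same contraction. -/
theorem height_eq_height_under (R : Type*) {S : Type*} [CommRing R] [CommRing S] [Algebra R S]
    [IsNoetherianRing R] [IsNoetherianRing S] [Algebra.IsIntegral R S] [Algebra.HasGoingDown R S]
    (P : Ideal S) [P.IsPrime] : P.height = (P.under R).height := by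
  rw [Ideal.height_eq_height_add_of_liesOver_of_hasGoingDown (P.under R) P]
  have hmin := Ideal.IsIntegral.mem_minimalPrimes_map_under (R := R) P
  have hP' := Ideal.isPrime_map_quotientMk_of_isPrime hmin.1.2
  have : P.map (Ideal.Quotient.mk ((P.under R).map (algebraMap R S))) ∈
      minimalPrimes (S ⧸ (P.under R).map (algebraMap R S)) := by
    refine ⟨⟨hP', bot_le⟩, fun Q hQ hle => ?_⟩
    rw [Ideal.map_le_iff_le_comap]
    have hQp : Q.IsPrime := hQ.1
    refine hmin.2 ⟨inferInstance, ?_⟩ ?_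
    · exact Ideal.mk_ker.symm.trans_le (Ideal.comap_mono bot_le)
    · exact (Ideal.comap_mono hle).trans_eq (Ideal.comap_map_mk hmin.1.2)
  rw [Ideal.height_eq_zero_iff.2 this, add_zero]

/-- Going down in `S/P₀` alone bounds heights in `S` from below. -/
theorem height_under_le_height {R S : Type*} [CommRing R] [CommRing S] [Algebra R S] [IsDomain R]
    [IsIntegrallyClosed R] [IsNoetherianRing R] [IsNoetherianRing S] [Algebra.IsIntegral R S]
    {P₀ P : Ideal S} [P₀.IsPrime] [P.IsPrime] (hle : P₀ ≤ P) (h₀ : P₀.under R = ⊥) :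
    (P.under R).height ≤ P.height := by
  have := faithfulSMul_quotient_of_under_eq_bot h₀
  have hP' : (P.map (Ideal.Quotient.mk P₀)).IsPrime := Ideal.isPrime_map_quotientMk_of_isPrime hle
  have hcomap : (P.map (Ideal.Quotient.mk P₀)).comap (Ideal.Quotient.mk P₀) = P :=
    Ideal.comap_map_mk hle
  have hunder : (P.map (Ideal.Quotient.mk P₀)).under R = P.under R := by
    conv_rhs => rw [← hcomap]
    rfl
  rw [← hunder, ← height_eq_height_under R (P.map (Ideal.Quotient.mk P₀))]
  have h := Order.height_le_height_apply_of_strictMono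
    (PrimeSpectrum.comap (Ideal.Quotient.mk P₀))
    (Monotone.strictMono_of_injective (fun Q Q' h => Ideal.comap_mono h)
      (PrimeSpectrum.comap_injective_of_surjective _ Ideal.Quotient.mk_surjective))
    ⟨P.map (Ideal.Quotient.mk P₀), hP'⟩
  rw [← PrimeSpectrum.height_eq_orderHeight, ← PrimeSpectrum.height_eq_orderHeight] at h
  refine h.trans_eq ?_
  conv_rhs => rw [← hcomap]
  rfl

/-! ### Depth and associated primes -/

/-- Passing to `M / rM` for a regular element `r` strictly enlarges some prime above a given
associated prime `P`. The submodule `N` of elements killed by `P` is nonzero, and `N ≤ rM` would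
give `N = rN`, against Nakayama; so a nonzero element of `M / rM` is killed by `P` and by `r`. -/
theorem exists_associatedPrime_quotSMulTop {R M : Type*} [CommRing R] [IsLocalRing R]
    [IsNoetherianRing R] [AddCommGroup M] [Module R M] [Module.Finite R M] {r : R}
    (hr : r ∈ IsLocalRing.maximalIdeal R) (hreg : IsSMulRegular M r) {P : Ideal R}
    (hP : P ∈ associatedPrimes R M) :
    ∃ P' ∈ associatedPrimes R (QuotSMulTop r M), P < P' := by
  obtain ⟨hPp, y, hy⟩ := isAssociatedPrime_iff.1 hP
  have hmem : ∀ a, a ∈ P ↔ a • y = 0 := fun a => by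
    rw [hy, Submodule.mem_colon_singleton, Submodule.mem_bot]
  have hy0 : y ≠ 0 := by
    rintro rfl
    exact hPp.ne_top ((Ideal.eq_top_iff_one _).2 ((hmem 1).2 (smul_zero _)))
  have hrP : r ∉ P := fun h => hy0 (hreg.right_eq_zero_of_smul ((hmem r).1 h))
  have hex : ∃ z : M, (∀ a ∈ P, a • z = 0) ∧ (Submodule.Quotient.mk z : QuotSMulTop r M) ≠ 0 := by
    by_contra! hcon
    set N : Submodule R M := Submodule.torsionBySet R M P with hN
    have hle : N ≤ IsLocalRing.maximalIdeal R • N := by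
      intro z hz
      have hz' : ∀ a ∈ P, a • z = 0 := fun a ha => (Submodule.mem_torsionBySet_iff _ _).1 hz ⟨a, ha⟩
      have := hcon z hz'
      rw [Submodule.Quotient.mk_eq_zero] at this
      obtain ⟨w, -, rfl⟩ := (Submodule.mem_smul_pointwise_iff_exists _ _ _).1 this
      refine Submodule.smul_mem_smul hr ?_
      refine (Submodule.mem_torsionBySet_iff _ _).2 fun a => hreg.right_eq_zero_of_smul ?_
      rw [smul_comm]
      exact hz' a a.2
    have hbot := Submodule.eq_bot_of_le_smul_of_le_jacobson_bot _ N
      (IsNoetherian.noetherian N) hle (IsLocalRing.maximalIdeal_le_jacobson _)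
    have : y ∈ N := (Submodule.mem_torsionBySet_iff _ _).2 fun a => (hmem a).1 a.2
    rw [hbot] at this
    exact hy0 this
  obtain ⟨z, hz, hz0⟩ := hex
  obtain ⟨P', hP', hle⟩ := exists_le_isAssociatedPrime_of_isNoetherianRing R _ hz0
  refine ⟨P', hP', lt_of_le_of_ne ?_ ?_⟩
  · intro a ha
    refine hle ?_
    rw [Submodule.mem_colon_singleton, Submodule.mem_bot, ← Submodule.Quotient.mk_smul, hz a ha,
      Submodule.Quotient.mk_zero]
  · rintro rfl
    refine hrP (hle ?_)
    rw [Submodule.mem_colon_singleton, Submodule.mem_bot, ← Submodule.Quotient.mk_smul,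
      Submodule.Quotient.mk_eq_zero]
    exact Submodule.smul_mem_pointwise_smul _ _ _ trivial

/-- The inequality `depth M ≤ dim R/P` for an associated prime `P` of `M`. -/
theorem length_le_ringKrullDim_quotient_of_mem_associatedPrimes {R : Type*} [CommRing R]
    [IsLocalRing R] [IsNoetherianRing R] {M : Type*} [AddCommGroup M] [Module R M]
    [Module.Finite R M] {rs : List R} (hrs : ∀ r ∈ rs, r ∈ IsLocalRing.maximalIdeal R)
    (hreg : RingTheory.Sequence.IsWeaklyRegular M rs) {P : Ideal R}
    (hP : P ∈ associatedPrimes R M) : (rs.length : WithBot ℕ∞) ≤ ringKrullDim (R ⧸ P) := by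
  induction rs generalizing M P with
  | nil =>
    have := hP.isPrime
    simpa using ringKrullDim_nonneg_of_nontrivial (R := R ⧸ P)
  | cons r rs ih =>
    rw [RingTheory.Sequence.isWeaklyRegular_cons_iff] at hreg
    obtain ⟨P', hP', hlt⟩ := exists_associatedPrime_quotSMulTop (hrs r (by simp)) hreg.1 hP
    have := hP.isPrime
    refine le_trans ?_ (ringKrullDim_quotient_add_one_le_of_lt hlt)
    have := ih (fun s hs => hrs s (by simp [hs])) hreg.2 hP'
    push_cast [List.length_cons]
    gcongr

/-- Cohen-Macaulay rings are unmixed: the components through a closed point have full dimension. -/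
theorem height_le_ringKrullDim_quotient_of_mem_minimalPrimes {A : Type*} [CommRing A]
    (hCM : IsCohenMacaulay A) {P 𝔪 : Ideal A} [𝔪.IsMaximal] (hP : P ∈ minimalPrimes A)
    (hP𝔪 : P ≤ 𝔪) : (𝔪.height : WithBot ℕ∞) ≤ ringKrullDim (A ⧸ P) := by
  obtain ⟨hN, hCM⟩ := hCM
  obtain ⟨rs, hrs, hreg, hlen⟩ := hCM 𝔪
  have hPp : P.IsPrime := hP.1.1
  have hass : P ∈ associatedPrimes A A := by
    refine Module.associatedPrimes.minimalPrimes_annihilator_subset_associatedPrimes A A ?_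
    rwa [Module.annihilator_eq_bot.2 inferInstance]
  have hdisj : Disjoint (𝔪.primeCompl : Set A) P :=
    Set.disjoint_left.2 fun x hx hxP => hx (hP𝔪 hxP)
  have hcomap : (P.map (algebraMap A (Localization.AtPrime 𝔪))).comap
      (algebraMap A (Localization.AtPrime 𝔪)) = P :=
    IsLocalization.under_map_of_isPrime_disjoint 𝔪.primeCompl _ hPp hdisj
  have hass' : P.map (algebraMap A (Localization.AtPrime 𝔪)) ∈
      associatedPrimes (Localization.AtPrime 𝔪) (Localization.AtPrime 𝔪) :=
    Module.associatedPrimes.mem_associatedPrimes_of_comap_mem_associatedPrimes_of_isLocalizedModule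
      𝔪.primeCompl (Algebra.linearMap A (Localization.AtPrime 𝔪)) _ (by rwa [hcomap])
  have h := length_le_ringKrullDim_quotient_of_mem_associatedPrimes hrs hreg.toIsWeaklyRegular hass'
  rw [hlen, IsLocalization.AtPrime.ringKrullDim_eq_height 𝔪] at h
  refine h.trans ?_
  rw [ringKrullDim_quotient, ringKrullDim_quotient]
  refine Order.krullDim_le_of_strictMono (fun Q =>
    ⟨PrimeSpectrum.comap (algebraMap A (Localization.AtPrime 𝔪)) Q.1, ?_⟩) ?_
  · have := Ideal.comap_mono (f := algebraMap A (Localization.AtPrime 𝔪)) Q.2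
    rw [hcomap] at this
    exact this
  · refine Monotone.strictMono_of_injective (fun Q Q' hle => Ideal.comap_mono hle) ?_
    intro Q Q' hQ
    exact Subtype.ext (PrimeSpectrum.localization_comap_injective _ 𝔪.primeCompl
      (congrArg Subtype.val hQ))

/-! ### Linear primes of polynomial rings -/

open MvPolynomial in
/-- Setting the variables in `s` to zero has the ideal generated by these variables as kernel. -/
theorem span_X_image_eq_ker {k σ : Type*} [CommRing k] (s : Set σ) [DecidablePred (· ∈ s)] :
    Ideal.span (X '' s : Set (MvPolynomial σ k)) =
      RingHom.ker (aeval fun i => if i ∈ s then 0 else X i :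
        MvPolynomial σ k →ₐ[k] MvPolynomial σ k) := by
  refine le_antisymm ?_ fun f hf => ?_
  · rw [Ideal.span_le]
    rintro _ ⟨i, hi, rfl⟩
    simp [hi]
  · have h : (Ideal.Quotient.mkₐ k (Ideal.span (X '' s : Set (MvPolynomial σ k)))).comp
        (aeval fun i => if i ∈ s then 0 else X i) = Ideal.Quotient.mkₐ k _ := by
      refine MvPolynomial.algHom_ext fun i => ?_
      by_cases hi : i ∈ s
      · simpa [hi] using (Ideal.Quotient.eq_zero_iff_mem.2
          (Ideal.subset_span (Set.mem_image_of_mem X hi))).symm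
      · simp [hi]
    have h' := DFunLike.congr_fun h f
    rw [AlgHom.comp_apply, (RingHom.mem_ker).1 hf, map_zero] at h'
    exact Ideal.Quotient.eq_zero_iff_mem.1 h'.symm

open MvPolynomial in
theorem isPrime_span_X_image {k σ : Type*} [CommRing k] [IsDomain k] (s : Set σ) :
    (Ideal.span (X '' s : Set (MvPolynomial σ k))).IsPrime := by
  classical
  rw [span_X_image_eq_ker]
  exact RingHom.ker_isPrime _

open MvPolynomial in
theorem X_mem_span_X_image_iff {k σ : Type*} [CommRing k] [Nontrivial k] {s : Set σ} {i : σ} :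
    (X i : MvPolynomial σ k) ∈ Ideal.span (X '' s : Set (MvPolynomial σ k)) ↔ i ∈ s := by
  classical
  rw [span_X_image_eq_ker, RingHom.mem_ker]
  by_cases hi : i ∈ s <;> simp [hi]

/-- The ideal `(X_0, …, X_{l-1})` of `k[X_0, …, X_{D-1}]`. -/
noncomputable def flagIdeal (k : Type*) [CommRing k] (D l : ℕ) : Ideal (MvPolynomial (Fin D) k) :=
  Ideal.span (MvPolynomial.X '' {i : Fin D | (i : ℕ) < l})

instance (k : Type*) [CommRing k] [IsDomain k] (D l : ℕ) : (flagIdeal k D l).IsPrime :=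
  isPrime_span_X_image _

theorem X_mem_flagIdeal_iff {k : Type*} [CommRing k] [Nontrivial k] {D l : ℕ} {i : Fin D} :
    MvPolynomial.X i ∈ flagIdeal k D l ↔ (i : ℕ) < l :=
  X_mem_span_X_image_iff

theorem flagIdeal_lt_succ (k : Type*) [CommRing k] [Nontrivial k] {D l : ℕ} (h : l < D) :
    flagIdeal k D l < flagIdeal k D (l + 1) := by
  refine lt_of_le_of_ne (Ideal.span_mono (Set.image_mono fun i hi => ?_)) fun he => ?_
  · exact Nat.lt_succ_of_lt hi
  · have : MvPolynomial.X ⟨l, h⟩ ∈ flagIdeal k D (l + 1) := X_mem_flagIdeal_iff.2 (Nat.lt_succ_self l)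
    rw [← he, X_mem_flagIdeal_iff] at this
    exact lt_irrefl _ this

theorem le_height_flagIdeal (k : Type*) [CommRing k] [IsDomain k] {D l : ℕ} (h : l ≤ D) :
    (l : ℕ∞) ≤ (flagIdeal k D l).height := by
  induction l with
  | zero => simp
  | succ l ih =>
    refine le_trans ?_ (Ideal.height_add_one_le_of_lt_of_isPrime (flagIdeal_lt_succ k h))
    push_cast
    gcongr
    exact ih (by omega)

theorem height_flagIdeal (k : Type*) [Field k] {D l : ℕ} (h : l ≤ D) :
    (flagIdeal k D l).height = l := by
  classical
  refine le_antisymm ?_ (le_height_flagIdeal k h)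
  have hmin : flagIdeal k D l ∈ (Ideal.span ((Finset.image MvPolynomial.X
      (Finset.univ.filter fun i : Fin D => (i : ℕ) < l) :
        Finset (MvPolynomial (Fin D) k)) : Set _)).minimalPrimes := by
    have he : Ideal.span ((Finset.image MvPolynomial.X
      (Finset.univ.filter fun i : Fin D => (i : ℕ) < l) :
        Finset (MvPolynomial (Fin D) k)) : Set _) = flagIdeal k D l := by
      simp [flagIdeal]
    rw [he, Ideal.minimalPrimes_eq_subsingleton_self]
    rfl
  refine (Ideal.height_le_card_of_mem_minimalPrimes_span_finset hmin).trans ?_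
  norm_cast
  refine Finset.card_image_le.trans ?_
  rw [Fin.card_filter_val_lt]
  exact min_le_right _ _

theorem ringKrullDim_quotient_flagIdeal_add_le (k : Type*) [Field k] {D l : ℕ} (h : l ≤ D) :
    ringKrullDim (MvPolynomial (Fin D) k ⧸ flagIdeal k D l) + (l : WithBot ℕ∞) ≤ (D : ℕ) := by
  induction l with
  | zero =>
    rw [Nat.cast_zero, add_zero]
    refine (ringKrullDim_quotient_le _).trans_eq ?_
    rw [MvPolynomial.ringKrullDim_of_isNoetherianRing, ringKrullDim_eq_zero_of_field, zero_add,
      Nat.card_eq_fintype_card, Fintype.card_fin]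
  | succ l ih =>
    refine le_trans ?_ (ih (by omega))
    rw [Nat.cast_succ, add_comm (l : WithBot ℕ∞), ← add_assoc]
    exact add_le_add (ringKrullDim_quotient_add_one_le_of_lt (flagIdeal_lt_succ k h)) le_rfl

theorem ringKrullDim_quotient_flagIdeal_eq_two (k : Type*) [Field k] {n : ℕ}
    (h : ringKrullDim (MvPolynomial (Fin (n + 1 + 1)) k ⧸ flagIdeal k (n + 1 + 1) (n + 1)) =
      (1 : ℕ)) :
    ringKrullDim (MvPolynomial (Fin (n + 1 + 1)) k ⧸ flagIdeal k (n + 1 + 1) n) = (1 + 1 : ℕ) := by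
  have h1 := ringKrullDim_quotient_add_one_le_of_lt
    (flagIdeal_lt_succ k (Nat.lt_succ_of_lt n.lt_succ_self))
  rw [h] at h1
  have h2 := ringKrullDim_quotient_flagIdeal_add_le k (D := n + 1 + 1) (l := n) (by omega)
  revert h1 h2
  generalize ringKrullDim (MvPolynomial (Fin (n + 1 + 1)) k ⧸ flagIdeal k (n + 1 + 1) n) = w
  intro h1 h2
  induction w using WithBot.recBotCoe with
  | bot => exact absurd h1 (by simp)
  | coe w =>
    induction w using ENat.recTopCoe with
    | top => exact absurd (top_le_iff.1 h2) (by norm_cast)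
    | coe w =>
      have h1' : ((1 + 1 : ℕ) : WithBot ℕ∞) ≤ (w : ℕ) := by
        rw [Nat.cast_add, Nat.cast_one]
        exact h1
      have h2' : ((w + n : ℕ) : WithBot ℕ∞) ≤ (n + 1 + 1 : ℕ) := by
        rw [Nat.cast_add]
        exact h2
      have h3 : 1 + 1 ≤ w := by exact_mod_cast h1'
      have h4 : w + n ≤ n + 1 + 1 := by exact_mod_cast h2'
      have h5 : w = 1 + 1 := by omega
      subst h5
      rfl

theorem isRegular_flag (k : Type*) [Field k] (n : ℕ) :
    RingTheory.Sequence.IsRegular (MvPolynomial (Fin (n + 1)) k)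
      (List.ofFn fun i : Fin n => (MvPolynomial.X i.castSucc : MvPolynomial (Fin (n + 1)) k)) := by
  have hspan : ∀ l ≤ n, Ideal.ofList ((List.ofFn fun i : Fin n =>
      (MvPolynomial.X i.castSucc : MvPolynomial (Fin (n + 1)) k)).take l) =
        flagIdeal k (n + 1) l := by
    intro l hl
    unfold Ideal.ofList flagIdeal
    congr 1
    ext f
    simp only [List.mem_take_iff_getElem, Set.mem_ofPred_eq, Set.mem_image, List.getElem_ofFn]
    constructor
    · rintro ⟨i, hi, rfl⟩
      refine ⟨_, ?_, rfl⟩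
      simp at hi ⊢
      omega
    · rintro ⟨i, hi, rfl⟩
      refine ⟨i, ?_, rfl⟩
      simp at hi ⊢
      omega
  constructor
  · rw [RingTheory.Sequence.isWeaklyRegular_iff]
    intro i hi
    have hi' : i < n := by simpa using hi
    rw [hspan i hi'.le, smul_eq_mul, Ideal.mul_top, List.getElem_ofFn]
    have hX : MvPolynomial.X (Fin.castSucc ⟨i, hi'⟩) ∉ flagIdeal k (n + 1) i := by
      simp [X_mem_flagIdeal_iff]
    rw [isSMulRegular_iff_right_eq_zero_of_smul]
    intro z hz
    obtain ⟨z, rfl⟩ := Ideal.Quotient.mk_surjective z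
    replace hz : Ideal.Quotient.mk (flagIdeal k (n + 1) i)
      (MvPolynomial.X (Fin.castSucc ⟨i, hi'⟩) * z) = 0 := hz
    rw [Ideal.Quotient.eq_zero_iff_mem] at hz
    rw [Ideal.Quotient.eq_zero_iff_mem]
    exact (Ideal.IsPrime.mem_or_mem inferInstance hz).resolve_left hX
  · have := hspan n le_rfl
    rw [List.take_of_length_le (by simp)] at this
    rw [this, smul_eq_mul, Ideal.mul_top]
    exact (Ideal.IsPrime.ne_top inferInstance).symm

open MvPolynomial in
/-- Projective Nullstellensatz in dimension zero. By the Nullstellensatz `P` vanishes at some point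
`x` other than the origin, and since `P` is homogeneous it vanishes on the line through `x`. -/
theorem exists_line_of_ringKrullDim_quotient_eq_one {k σ : Type*} [Field k] [IsAlgClosed k]
    [Finite σ] {P : Ideal (MvPolynomial σ k)} [P.IsPrime]
    (hhom : ∀ f ∈ P, ∀ N, homogeneousComponent N f ∈ P)
    (hdim : ringKrullDim (MvPolynomial σ k ⧸ P) = (1 : ℕ)) :
    ∃ (x : σ → k) (j : σ), x j ≠ 0 ∧
      P ≤ RingHom.ker (aeval fun i => Polynomial.C (x i) * Polynomial.X :
        MvPolynomial σ k →ₐ[k] Polynomial k) := by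
  have hj : ∃ j, X j ∉ P := by
    by_contra! h
    have hsurj : Function.Surjective ((Ideal.Quotient.mk P).comp C) := by
      intro z
      obtain ⟨f, rfl⟩ := Ideal.Quotient.mk_surjective z
      induction f using MvPolynomial.induction_on with
      | C a => exact ⟨a, rfl⟩
      | add f g hf hg =>
        obtain ⟨a, ha⟩ := hf
        obtain ⟨b, hb⟩ := hg
        exact ⟨a + b, by rw [map_add, map_add, ha, hb]⟩
      | mul_X f i _ =>
        exact ⟨0, by rw [map_zero, map_mul, Ideal.Quotient.eq_zero_iff_mem.2 (h i), mul_zero]⟩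
    have := ringKrullDim_le_of_surjective _ hsurj
    rw [hdim, ringKrullDim_eq_zero_of_field] at this
    exact absurd this (by norm_num)
  obtain ⟨j, hj⟩ := hj
  rw [← IsPrime.vanishingIdeal_zeroLocus (K := k) P, mem_vanishingIdeal_iff] at hj
  push Not at hj
  obtain ⟨x, hx, hxj⟩ := hj
  refine ⟨x, j, by simpa using hxj, fun f hf => ?_⟩
  have hline : ∀ N (g : MvPolynomial σ k), g.IsHomogeneous N →
      aeval (fun i => Polynomial.C (x i) * Polynomial.X) g =
        Polynomial.C (aeval x g) * Polynomial.X ^ N := by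
    intro N g hg
    rw [g.as_sum, map_sum, map_sum, map_sum, Finset.sum_mul]
    refine Finset.sum_congr rfl fun s hs => ?_
    have hsN : s.degree = N := by
      rw [← hg (mem_support_iff.1 hs), Finsupp.degree_eq_weight_one]
      rfl
    rw [aeval_monomial, aeval_monomial, ← hsN, Finsupp.degree_apply]
    simp [Finsupp.prod, mul_pow, Finset.prod_mul_distrib, Finset.prod_pow_eq_pow_sum, mul_assoc,
      Polynomial.algebraMap_eq]
  rw [RingHom.mem_ker, ← sum_homogeneousComponent f, map_sum]
  refine Finset.sum_eq_zero fun N _ => ?_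
  rw [hline N _ (homogeneousComponent_isHomogeneous N f), hx _ (hhom f hf N)]
  simp

open MvPolynomial in
/-- A homogeneous prime with one-dimensional quotient is generated by all but one of the variables,
after a linear change of coordinates. -/
theorem exists_linear_coordinates {k : Type*} [Field k] [IsAlgClosed k] {n : ℕ}
    {P : Ideal (MvPolynomial (Fin (n + 1)) k)} [P.IsPrime]
    (hhom : ∀ f ∈ P, ∀ N, homogeneousComponent N f ∈ P)
    (hdim : ringKrullDim (MvPolynomial (Fin (n + 1)) k ⧸ P) = (1 : ℕ)) :
    ∃ θ : MvPolynomial (Fin (n + 1)) k ≃ₐ[k] MvPolynomial (Fin (n + 1)) k,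
      (∀ i, (θ (X i)).IsHomogeneous 1) ∧
        P.comap (θ : MvPolynomial (Fin (n + 1)) k →+* MvPolynomial (Fin (n + 1)) k) =
          flagIdeal k (n + 1) n := by
  obtain ⟨x, j, hxj, hP⟩ := exists_line_of_ringKrullDim_quotient_eq_one hhom hdim
  -- `θ` sends the last variable to `X_j` and the others to the equations `X_l - (x_l / x_j) X_j`
  -- of the line through `x`.
  set σ : Equiv.Perm (Fin (n + 1)) := Equiv.swap j (Fin.last n)
  have hσσ : ∀ i, σ (σ i) = i := fun i => Equiv.swap_apply_self _ _ i
  have hσj : σ j = Fin.last n := Equiv.swap_apply_left _ _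
  have hσl : σ (Fin.last n) = j := Equiv.swap_apply_right _ _
  set c : Fin (n + 1) → k := fun l => x l / x j
  set θ₁ : MvPolynomial (Fin (n + 1)) k →ₐ[k] MvPolynomial (Fin (n + 1)) k :=
    aeval fun i => if i = Fin.last n then X j else X (σ i) - C (c (σ i)) * X j with hθ₁
  set θ₂ : MvPolynomial (Fin (n + 1)) k →ₐ[k] MvPolynomial (Fin (n + 1)) k :=
    aeval fun l => if l = j then X (Fin.last n) else X (σ l) + C (c l) * X (Fin.last n) with hθ₂
  have h1 : ∀ i, θ₁ (X i) = if i = Fin.last n then X j else X (σ i) - C (c (σ i)) * X j :=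
    fun i => aeval_X _ i
  have h2 : ∀ i, θ₂ (X i) = if i = j then X (Fin.last n) else X (σ i) + C (c i) * X (Fin.last n) :=
    fun i => aeval_X _ i
  have h1C : ∀ a, θ₁ (C a) = C a := fun a => θ₁.commutes a
  have h2C : ∀ a, θ₂ (C a) = C a := fun a => θ₂.commutes a
  let θ := AlgEquiv.ofAlgHom θ₁ θ₂
    (by
      refine MvPolynomial.algHom_ext fun l => ?_
      by_cases hl : l = j
      · simp [h1, h2, hl]
      · have : σ l ≠ Fin.last n := fun h => hl (by rw [← hσσ l, h, hσl])
        simp [h1, h2, hl, this, hσσ, h1C])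
    (by
      refine MvPolynomial.algHom_ext fun l => ?_
      by_cases hl : l = Fin.last n
      · simp [h1, h2, hl]
      · have : σ l ≠ j := fun h => hl (by rw [← hσσ l, h, hσj])
        simp [h1, h2, hl, this, hσσ, h2C])
  have hθ : ∀ f, θ f = θ₁ f := fun f => rfl
  refine ⟨θ, fun i => ?_, ?_⟩
  · rw [hθ, h1]
    split_ifs
    · exact isHomogeneous_X _ _
    · refine (isHomogeneous_X _ _).sub ?_
      simpa using (isHomogeneous_C _ (c (σ i))).mul (isHomogeneous_X k j)
  have hker : P.comap (θ : MvPolynomial (Fin (n + 1)) k →+* MvPolynomial (Fin (n + 1)) k) ≤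
      flagIdeal k (n + 1) n := by
    intro f hf
    have hf0 : aeval (fun i => Polynomial.C (x i) * Polynomial.X : Fin (n + 1) → Polynomial k)
      (θ₁ f) = 0 := hP hf
    rw [flagIdeal, span_X_image_eq_ker, RingHom.mem_ker]
    -- Restricting to the line and then sending its parameter to `X_n / x_j` kills all variables
    -- but the last, in the coordinates `θ`.
    have hcomp : ((Polynomial.aeval (C (x j)⁻¹ * X (Fin.last n)) :
          Polynomial k →ₐ[k] MvPolynomial (Fin (n + 1)) k).comp
        ((aeval (fun i => Polynomial.C (x i) * Polynomial.X : Fin (n + 1) → Polynomial k)).comp θ₁))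
        = aeval fun i => if i ∈ {i : Fin (n + 1) | (i : ℕ) < n} then 0 else X i := by
      refine MvPolynomial.algHom_ext fun i => ?_
      by_cases hi : i = Fin.last n
      · simp only [AlgHom.comp_apply, h1, hi, if_true, aeval_X, map_mul, Polynomial.aeval_C,
          Polynomial.aeval_X, Set.mem_ofPred_eq, Fin.val_last, lt_irrefl, if_false, algebraMap_eq]
        rw [← mul_assoc, ← C_mul, mul_inv_cancel₀ hxj, C_1, one_mul]
      · have hi' : (i : ℕ) < n := lt_of_le_of_ne (Nat.lt_succ_iff.1 i.2) fun h => hi (Fin.ext h)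
        have hcx : c (σ i) * x j = x (σ i) := div_mul_cancel₀ _ hxj
        have hz : aeval (fun i => Polynomial.C (x i) * Polynomial.X : Fin (n + 1) → Polynomial k)
            (X (σ i) - C (c (σ i)) * X j) = 0 := by
          rw [map_sub, map_mul, aeval_X, aeval_X, aeval_C, ← hcx, Polynomial.algebraMap_eq,
            Polynomial.C_mul]
          ring
        rw [AlgHom.comp_apply, AlgHom.comp_apply, h1, if_neg hi, hz, map_zero, aeval_X,
          if_pos (by exact hi')]
    rw [← hcomp, AlgHom.comp_apply, AlgHom.comp_apply, hf0, map_zero]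
  -- Both primes have a quotient of dimension one, so the inclusion cannot be strict.
  refine hker.eq_of_not_lt fun hlt => ?_
  have hq : ringKrullDim (MvPolynomial (Fin (n + 1)) k ⧸
      P.comap (θ : MvPolynomial (Fin (n + 1)) k →+* MvPolynomial (Fin (n + 1)) k)) = (1 : ℕ) := by
    rw [← hdim]
    refine ringKrullDim_eq_of_ringEquiv (Ideal.quotientEquiv _ P θ.toRingEquiv ?_)
    exact (Ideal.map_comap_of_surjective _ θ.surjective P).symm
  have h3 := ringKrullDim_quotient_add_one_le_of_lt hlt
  have h4 : (0 + 1 : WithBot ℕ∞) ≤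
      ringKrullDim (MvPolynomial (Fin (n + 1)) k ⧸ flagIdeal k (n + 1) n) :=
    (add_le_add ringKrullDim_nonneg_of_nontrivial le_rfl).trans
      (ringKrullDim_quotient_add_one_le_of_lt (flagIdeal_lt_succ k n.lt_succ_self))
  rw [hq] at h3
  have h5 : ((0 + 1 + 1 : ℕ) : WithBot ℕ∞) ≤ (1 : ℕ) := by
    refine le_trans (le_of_eq ?_) ((add_le_add h4 le_rfl).trans h3)
    norm_num
  exact absurd (by exact_mod_cast h5 : 0 + 1 + 1 ≤ 1) (by norm_num)

/-! ### Coordinates of a Noether normalization -/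

section Coordinates

variable {k A : Type*} [Field k] [CommRing A] [Algebra k A] (𝒜 : ℕ → Submodule k A)
  {d m : ℕ} {T : Subalgebra k A}

theorem mem_degree_of_isHomogeneous [GradedAlgebra 𝒜] (e : MvPolynomial (Fin d) k ≃ₐ[k] T)
    (he : ∀ i, (e (MvPolynomial.X i) : A) ∈ 𝒜 m) {F : MvPolynomial (Fin d) k} {N : ℕ}
    (hF : F.IsHomogeneous N) : (e F : A) ∈ 𝒜 (N * m) := by
  rw [F.as_sum, map_sum, AddSubmonoidClass.coe_finsetSum]
  refine sum_mem fun s hs => ?_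
  have hsN : s.degree = N := by
    rw [← hF (MvPolynomial.mem_support_iff.1 hs), Finsupp.degree_eq_weight_one]
    rfl
  rw [MvPolynomial.monomial_eq, map_mul, ← MvPolynomial.algebraMap_eq, AlgEquiv.commutes,
    ← Algebra.smul_def, Finsupp.prod, map_prod, SetLike.val_smul]
  refine Submodule.smul_mem _ _ ?_
  rw [SubmonoidClass.coe_finsetProd, ← hsN, Finsupp.degree_apply, Finset.sum_mul]
  refine SetLike.prod_mem_graded _ _ _ fun i _ => ?_
  rw [map_pow, SubmonoidClass.coe_pow]
  exact SetLike.pow_mem_graded _ (he i)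

theorem decompose_coordinates [GradedAlgebra 𝒜] (hm : 0 < m) (e : MvPolynomial (Fin d) k ≃ₐ[k] T)
    (he : ∀ i, (e (MvPolynomial.X i) : A) ∈ 𝒜 m) (F : MvPolynomial (Fin d) k) (N : ℕ) :
    (DirectSum.decompose 𝒜 (e F : A) (N * m) : A) = e (MvPolynomial.homogeneousComponent N F) := by
  have key : ∀ N', (DirectSum.decompose 𝒜 (e (MvPolynomial.homogeneousComponent N' F) : A)
      (N * m) : A) = if N' = N then (e (MvPolynomial.homogeneousComponent N F) : A) else 0 := by
    intro N'
    have hmem := mem_degree_of_isHomogeneous 𝒜 e he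
      (MvPolynomial.homogeneousComponent_isHomogeneous N' F)
    split_ifs with h
    · subst h
      exact DirectSum.decompose_of_mem_same 𝒜 hmem
    · exact DirectSum.decompose_of_mem_ne 𝒜 hmem fun h' => h (Nat.eq_of_mul_eq_mul_right hm h')
  conv_lhs => rw [← MvPolynomial.sum_homogeneousComponent F]
  rw [map_sum, AddSubmonoidClass.coe_finsetSum, ← GradedRing.proj_apply, map_sum]
  simp only [GradedRing.proj_apply, key]
  rw [Finset.sum_ite_eq' _ N]
  split_ifs with h
  · rfl
  · rw [MvPolynomial.homogeneousComponent_eq_zero _ _ (by simpa using h), map_zero]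
    rfl

theorem IsNoetherNormalization.exists_algEquiv {X : Fin d → A}
    (hT : IsNoetherNormalization 𝒜 m X T) :
    ∃ e : MvPolynomial (Fin d) k ≃ₐ[k] T, ∀ i, (e (MvPolynomial.X i) : A) ∈ 𝒜 m := by
  obtain ⟨h1, h2, rfl, -⟩ := hT
  refine ⟨h2.aevalEquiv, fun i => ?_⟩
  simpa using h1 i

/-- In degree zero there are only constants, which are not algebraically independent. -/
theorem degree_pos [GradedAlgebra 𝒜] (hA0 : 𝒜 0 = 1) (hd : 0 < d) (e : MvPolynomial (Fin d) k ≃ₐ[k] T)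
    (he : ∀ i, (e (MvPolynomial.X i) : A) ∈ 𝒜 m) : 0 < m := by
  rw [Nat.pos_iff_ne_zero]
  rintro rfl
  have h := he ⟨0, hd⟩
  rw [hA0, Submodule.mem_one] at h
  obtain ⟨c, hc⟩ := h
  have : e (MvPolynomial.C c) = e (MvPolynomial.X ⟨0, hd⟩) := by
    refine Subtype.ext ?_
    rw [← hc, ← MvPolynomial.algebraMap_eq, AlgEquiv.commutes]
    rfl
  have h' := congrArg MvPolynomial.totalDegree (e.injective this)
  rw [MvPolynomial.totalDegree_C, MvPolynomial.totalDegree_X] at h'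
  exact zero_ne_one h'

variable {R : Subalgebra T A} (ℛ : ℕ → AddSubgroup R) [GradedRing ℛ]

theorem coe_decompose [GradedAlgebra 𝒜] (hR : ∀ (n : ℕ) (r : R), r ∈ ℛ n → (r : A) ∈ 𝒜 n)
    (r : R) (j : ℕ) :
    ((DirectSum.decompose ℛ r j : R) : A) = DirectSum.decompose 𝒜 (r : A) j := by
  induction r using DirectSum.Decomposition.inductionOn ℛ with
  | zero => simp
  | @homogeneous i r =>
    have hr := hR i r r.2
    by_cases h : i = j
    · subst h
      rw [DirectSum.decompose_of_mem_same ℛ r.2, DirectSum.decompose_of_mem_same 𝒜 hr]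
    · rw [DirectSum.decompose_of_mem_ne ℛ r.2 h, DirectSum.decompose_of_mem_ne 𝒜 hr h]
      rfl
  | add r s hr hs =>
    simp only [DirectSum.decompose_add, DirectSum.add_apply, AddSubgroup.coe_add,
      Submodule.coe_add, ← hr, ← hs, Subalgebra.coe_add]

theorem mem_degree_of_coe_mem [GradedAlgebra 𝒜]
    (hR : ∀ (n : ℕ) (r : R), r ∈ ℛ n → (r : A) ∈ 𝒜 n) {r : R} {n : ℕ} (hr : (r : A) ∈ 𝒜 n) :
    r ∈ ℛ n := by
  have h : ((DirectSum.decompose ℛ r n : R) : A) = r := by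
    rw [coe_decompose 𝒜 ℛ hR, DirectSum.decompose_of_mem_same 𝒜 hr]
  rw [← Subtype.ext h]
  exact (DirectSum.decompose ℛ r n).2

/-- In suitable homogeneous coordinates of degree `m` on `T`, the trace on `T` of a homogeneous
prime of `R` is generated by all but the last coordinate. -/
theorem exists_coordinates_of_ringKrullDim_quotient_eq_one [GradedAlgebra 𝒜] [IsAlgClosed k]
    (hR : ∀ (n : ℕ) (r : R), r ∈ ℛ n → (r : A) ∈ 𝒜 n) (hA0 : 𝒜 0 = 1) {n : ℕ}
    {X : Fin (n + 1) → A} (hT : IsNoetherNormalization 𝒜 m X T) {P : Ideal R} [P.IsPrime]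
    (hP : P.IsHomogeneous ℛ) (hdim : ringKrullDim (T ⧸ P.under T) = (1 : ℕ)) :
    ∃ e : MvPolynomial (Fin (n + 1)) k ≃ₐ[k] T, (∀ i, (e (MvPolynomial.X i) : A) ∈ 𝒜 m) ∧
      (P.under T).comap (e : MvPolynomial (Fin (n + 1)) k →+* T) = flagIdeal k (n + 1) n := by
  obtain ⟨e₀, he₀⟩ := hT.exists_algEquiv
  have hm := degree_pos 𝒜 hA0 n.succ_pos e₀ he₀
  have hhom : ∀ f ∈ (P.under T).comap (e₀ : MvPolynomial (Fin (n + 1)) k →+* T), ∀ N,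
      MvPolynomial.homogeneousComponent N f ∈
        (P.under T).comap (e₀ : MvPolynomial (Fin (n + 1)) k →+* T) := by
    intro f hf N
    have h1 : algebraMap T R (e₀ f) ∈ P := hf
    have h2 := hP (N * m) h1
    have h3 : (DirectSum.decompose ℛ (algebraMap T R (e₀ f)) (N * m) : R) =
        algebraMap T R (e₀ (MvPolynomial.homogeneousComponent N f)) := by
      refine Subtype.ext ?_
      rw [coe_decompose 𝒜 ℛ hR]
      exact decompose_coordinates 𝒜 hm e₀ he₀ f N
    rw [h3] at h2
    exact h2
  have hq : ringKrullDim (MvPolynomial (Fin (n + 1)) k ⧸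
      (P.under T).comap (e₀ : MvPolynomial (Fin (n + 1)) k →+* T)) = (1 : ℕ) := by
    rw [← hdim]
    refine ringKrullDim_eq_of_ringEquiv (Ideal.quotientEquiv _ _ e₀.toRingEquiv ?_)
    exact (Ideal.map_comap_of_surjective _ e₀.surjective _).symm
  obtain ⟨θ, hθ, hθP⟩ := exists_linear_coordinates hhom hq
  refine ⟨θ.trans e₀, fun i => ?_, hθP⟩
  simpa using mem_degree_of_isHomogeneous 𝒜 e₀ he₀ (hθ i)

end Coordinates

/-! ### Cohen-Macaulay graded algebras over a Noether normalization -/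

section CohenMacaulay

variable {k A : Type*} [Field k] [CommRing A] [Algebra k A] (𝒜 : ℕ → Submodule k A)
  [GradedAlgebra 𝒜]

theorem exists_algebraMap_eq_decompose_zero (hA0 : 𝒜 0 = 1) (a : A) :
    ∃ c : k, algebraMap k A c = DirectSum.decompose 𝒜 a 0 :=
  Submodule.mem_one.1 (hA0.le (DirectSum.decompose 𝒜 a 0).2)

theorem isMaximal_irrelevant [Nontrivial A] (hA0 : 𝒜 0 = 1) :
    (HomogeneousIdeal.irrelevant 𝒜).toIdeal.IsMaximal := by
  rw [Ideal.isMaximal_iff]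
  constructor
  · rw [HomogeneousIdeal.mem_iff, HomogeneousIdeal.mem_irrelevant_iff, GradedRing.proj_apply,
      DirectSum.decompose_of_mem_same 𝒜 SetLike.GradedOne.one_mem]
    exact one_ne_zero
  · intro J a hJ ha haJ
    obtain ⟨c, hc⟩ := exists_algebraMap_eq_decompose_zero 𝒜 hA0 a
    rw [HomogeneousIdeal.mem_iff, HomogeneousIdeal.mem_irrelevant_iff, GradedRing.proj_apply,
      ← hc] at ha
    have hc0 : c ≠ 0 := by
      rintro rfl
      exact ha (map_zero _)
    have hsub : a - algebraMap k A c ∈ J := by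
      refine hJ ?_
      rw [HomogeneousIdeal.mem_iff, HomogeneousIdeal.mem_irrelevant_iff, map_sub,
        GradedRing.proj_apply, GradedRing.proj_apply, ← hc, DirectSum.decompose_of_mem_same 𝒜,
        sub_self]
      rw [hA0]
      exact Submodule.mem_one.2 ⟨c, rfl⟩
    have hcJ : algebraMap k A c ∈ J := by simpa using J.sub_mem haJ hsub
    have := J.mul_mem_left (algebraMap k A c⁻¹) hcJ
    rwa [← map_mul, inv_mul_cancel₀ hc0, map_one] at this

theorem le_irrelevant_of_mem_minimalPrimes (hA0 : 𝒜 0 = 1) {P : Ideal A}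
    (hP : P ∈ minimalPrimes A) : P ≤ (HomogeneousIdeal.irrelevant 𝒜).toIdeal := by
  have hPp : P.IsPrime := hP.1.1
  have hcore : P ≤ (P.homogeneousCore 𝒜).toIdeal :=
    hP.2 ⟨hPp.homogeneousCore, bot_le⟩ (Ideal.toIdeal_homogeneousCore_le 𝒜 P)
  intro a ha
  have h0 := Ideal.toIdeal_homogeneousCore_le 𝒜 P
    ((P.homogeneousCore 𝒜).isHomogeneous 0 (hcore ha))
  obtain ⟨c, hc⟩ := exists_algebraMap_eq_decompose_zero 𝒜 hA0 a
  rw [HomogeneousIdeal.mem_iff, HomogeneousIdeal.mem_irrelevant_iff, GradedRing.proj_apply, ← hc]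
  rw [← hc] at h0
  by_contra hne
  have hc0 : c ≠ 0 := by
    rintro rfl
    exact hne (map_zero _)
  exact hPp.ne_top (Ideal.eq_top_of_isUnit_mem _ h0 ((IsUnit.mk0 c hc0).map _))

/-- The maximal ideal `A_+` has full height: some minimal prime of `A` contracts to zero in `T`, is
contained in `A_+`, and going down holds modulo it. -/
theorem le_height_irrelevant [Nontrivial A] [IsNoetherianRing A] {d m : ℕ} {T : Subalgebra k A}
    [IsDomain T] [IsIntegrallyClosed T] [IsNoetherianRing T] [Algebra.IsIntegral T A]
    (hA0 : 𝒜 0 = 1) (hm : 0 < m) (e : MvPolynomial (Fin d) k ≃ₐ[k] T)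
    (he : ∀ i, (e (MvPolynomial.X i) : A) ∈ 𝒜 m) :
    (d : ℕ∞) ≤ (HomogeneousIdeal.irrelevant 𝒜).toIdeal.height := by
  have hmax := isMaximal_irrelevant 𝒜 hA0
  obtain ⟨Q, -, hQ, hQT⟩ := Ideal.exists_ideal_over_prime_of_isIntegral (⊥ : Ideal T) (⊥ : Ideal A)
    (by
      rw [← RingHom.ker_eq_comap_bot, (RingHom.injective_iff_ker_eq_bot _).1
        (FaithfulSMul.algebraMap_injective T A)])
  obtain ⟨P, hP, hPQ⟩ := Ideal.exists_minimalPrimes_le (bot_le : (⊥ : Ideal A) ≤ Q)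
  have hPp : P.IsPrime := hP.1.1
  have hPT : P.under T = ⊥ := le_bot_iff.1 ((Ideal.comap_mono hPQ).trans_eq hQT)
  refine le_trans ?_ (height_under_le_height (R := T)
    (le_irrelevant_of_mem_minimalPrimes 𝒜 hA0 hP) hPT)
  rw [← RingEquiv.height_comap e.toRingEquiv]
  refine (le_height_flagIdeal k le_rfl).trans (Ideal.height_mono ?_)
  rw [flagIdeal, Ideal.span_le]
  rintro _ ⟨i, -, rfl⟩
  exact HomogeneousIdeal.mem_irrelevant_of_mem 𝒜 hm (he i)

/-- Unmixedness of `A` at `A_+` shows that every component of `Spec A` has dimension `d` and hence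
dominates `Spec T`. -/
theorem under_eq_bot_of_mem_minimalPrimes {d m : ℕ} {T : Subalgebra k A}
    [IsDomain T] [IsIntegrallyClosed T] [IsNoetherianRing T] [Algebra.IsIntegral T A]
    (hCM : IsCohenMacaulay A) (hdim : ringKrullDim A = (d : WithBot ℕ∞))
    (hA0 : 𝒜 0 = 1) (hm : 0 < m) (e : MvPolynomial (Fin d) k ≃ₐ[k] T)
    (he : ∀ i, (e (MvPolynomial.X i) : A) ∈ 𝒜 m) {P : Ideal A} (hP : P ∈ minimalPrimes A) :
    P.under T = ⊥ := by
  have hPp : P.IsPrime := hP.1.1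
  have : Nontrivial A := ⟨0, 1, fun h => hPp.ne_top ((Ideal.eq_top_iff_one _).2 (h ▸ P.zero_mem))⟩
  have := hCM.1
  have hmax := isMaximal_irrelevant 𝒜 hA0
  have h1 := height_le_ringKrullDim_quotient_of_mem_minimalPrimes hCM hP
    (le_irrelevant_of_mem_minimalPrimes 𝒜 hA0 hP)
  rw [ringKrullDim_quotient_under T] at h1
  have h2 : ((d : ℕ∞) : WithBot ℕ∞) ≤ ringKrullDim (T ⧸ P.under T) :=
    le_trans (by exact_mod_cast le_height_irrelevant 𝒜 hA0 hm e he) h1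
  by_contra hne
  have h3 := ringKrullDim_quotient_add_one_le_of_lt (bot_lt_iff_ne_bot.2 hne)
  rw [ringKrullDim_eq_of_ringEquiv (RingEquiv.quotientBot T), ← ringKrullDim_eq_of_isIntegral T A,
    hdim] at h3
  have h4 : ((d + 1 : ℕ) : WithBot ℕ∞) ≤ (d : ℕ) := by
    push_cast
    exact (add_le_add h2 le_rfl).trans h3
  exact absurd (by exact_mod_cast h4 : d + 1 ≤ d) (by omega)

end CohenMacaulay

section Uniqueness

variable {k A : Type*} [Field k] [CommRing A] [Algebra k A] {𝒜 : ℕ → Submodule k A}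

/-- A prime of `A` over a prime of `T` generated by `n` coordinates is minimal over the ideal of `A`
generated by these coordinates and has height `n`, so it is the only member of the set of associated
primes in the hypothesis. -/
theorem eq_of_under_comap_eq_flagIdeal [IsNoetherianRing A] {n m : ℕ} {T : Subalgebra k A}
    [IsNoetherianRing T] [Algebra.IsIntegral T A] [Algebra.HasGoingDown T A]
    (hass : ∀ u : Fin n → T, (∀ i, (u i : A) ∈ 𝒜 m) →
      RingTheory.Sequence.IsRegular T (List.ofFn u) →
      (assOfHeight A (A ⧸ Ideal.span (Set.range fun i => (u i : A))) n).encard = 1)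
    (e : MvPolynomial (Fin (n + 1)) k ≃ₐ[k] T) (he : ∀ i, (e (MvPolynomial.X i) : A) ∈ 𝒜 m)
    {P₁ P₂ : Ideal A} [P₁.IsPrime] [P₂.IsPrime]
    (h₁ : (P₁.under T).comap (e : MvPolynomial (Fin (n + 1)) k →+* T) = flagIdeal k (n + 1) n)
    (h₂ : (P₂.under T).comap (e : MvPolynomial (Fin (n + 1)) k →+* T) = flagIdeal k (n + 1) n) :
    P₁ = P₂ := by
  set u : Fin n → T := fun i => e (MvPolynomial.X i.castSucc) with hu
  have hreg : RingTheory.Sequence.IsRegular T (List.ofFn u) := by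
    have h := isRegular_flag k n
    rw [AddEquiv.isRegular_congr (e := e.toRingEquiv.toAddEquiv) (bs := List.ofFn u)] at h
    · exact h
    · rw [List.forall₂_iff_get]
      refine ⟨by simp, fun i hi hi' x => ?_⟩
      simp [hu]
  have hcard := hass u (fun i => he _) hreg
  obtain ⟨Q, hQ⟩ := Set.encard_eq_one.1 hcard
  have key : ∀ P : Ideal A, P.IsPrime →
      (P.under T).comap (e : MvPolynomial (Fin (n + 1)) k →+* T) = flagIdeal k (n + 1) n →
      P ∈ assOfHeight A (A ⧸ Ideal.span (Set.range fun i => (u i : A))) n := by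
    intro P _ hP
    have hmap : (P.under T).map (algebraMap T A) =
        Ideal.span (Set.range fun i => (u i : A)) := by
      rw [← Ideal.map_comap_of_surjective (e : MvPolynomial (Fin (n + 1)) k →+* T) e.surjective
        (P.under T), hP, flagIdeal, Ideal.map_span, Ideal.map_span, Set.image_image,
        Set.image_image]
      congr 1
      ext a
      constructor
      · rintro ⟨i, hi, rfl⟩
        exact ⟨⟨i, hi⟩, rfl⟩
      · rintro ⟨i, rfl⟩
        exact ⟨i.castSucc, i.2, rfl⟩
    constructor
    · refine Module.associatedPrimes.minimalPrimes_annihilator_subset_associatedPrimes A _ ?_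
      rw [Ideal.annihilator_quotient, ← hmap]
      exact Ideal.IsIntegral.mem_minimalPrimes_map_under P
    · rw [height_eq_height_under T P, ← RingEquiv.height_comap e.toRingEquiv]
      exact (congrArg Ideal.height hP).trans (height_flagIdeal k n.le_succ)
  have hP₁ := key P₁ inferInstance h₁
  have hP₂ := key P₂ inferInstance h₂
  rw [hQ] at hP₁ hP₂
  exact hP₁.trans hP₂.symm

end Uniqueness

/-! ### Divisors supported at a single prime -/

section Divisor

variable {ι σ R : Type*} [DecidableEq ι] [AddMonoid ι] [CommRing R] [SetLike σ R]
  [AddSubgroupClass σ R] (ℛ : ι → σ) [GradedRing ℛ]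

theorem mem_support_quotSMulTop_quotient_iff {Q : Ideal R} {x : R} {P : PrimeSpectrum R} :
    P ∈ Module.support R (QuotSMulTop x (R ⧸ Q)) ↔ Q ≤ P.asIdeal ∧ x ∈ P.asIdeal := by
  rw [Module.support_quotSMulTop, Module.support_eq_zeroLocus, Ideal.annihilator_quotient,
    Set.mem_inter_iff, PrimeSpectrum.mem_zeroLocus, PrimeSpectrum.mem_zeroLocus,
    Set.singleton_subset_iff]
  rfl

theorem localLength_eq_zero_iff {P : Ideal R} [hP : P.IsPrime] {M : Type*} [AddCommGroup M]
    [Module R M] : localLength P M = 0 ↔ (⟨P, hP⟩ : PrimeSpectrum R) ∉ Module.support R M := by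
  rw [Module.notMem_support_iff, localLength, Module.length_eq_zero_iff]

/-- The localization of a finite module at a minimal prime of its support has finite length. -/
theorem localLength_ne_top [IsNoetherianRing R] {P : Ideal R} [P.IsPrime] {M : Type*}
    [AddCommGroup M] [Module R M] [Module.Finite R M]
    (hmin : ∀ P' : Ideal R, P'.IsPrime → Module.annihilator R M ≤ P' → P' ≤ P → P' = P) :
    localLength P M ≠ ⊤ := by
  set L := Localization.AtPrime P
  set N := LocalizedModule P.primeCompl M
  have hann : ∀ a ∈ Module.annihilator R M, algebraMap R L a ∈ Module.annihilator L N := by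
    intro a ha
    rw [Module.mem_annihilator] at ha ⊢
    intro z
    induction z using LocalizedModule.induction_on with
    | h z s => rw [algebraMap_smul, LocalizedModule.smul'_mk, ha, LocalizedModule.zero_mk]
  -- The only prime containing the annihilator is the maximal ideal.
  have hart : IsArtinianRing (L ⧸ Module.annihilator L N) := by
    refine isArtinianRing_iff_isNoetherianRing_krullDimLE_zero.2
      ⟨inferInstance, Ring.KrullDimLE.mk₀ fun I hI => ?_⟩
    have hle : Module.annihilator L N ≤ I.comap (Ideal.Quotient.mk _) :=
      Ideal.mk_ker.symm.trans_le (Ideal.comap_mono bot_le)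
    have hIP : (I.comap (Ideal.Quotient.mk (Module.annihilator L N))).under R = P := by
      refine hmin _ inferInstance (fun a ha => hle (hann a ha)) ?_
      exact (Ideal.comap_mono (IsLocalRing.le_maximalIdeal
        (Ideal.IsPrime.ne_top inferInstance))).trans_eq Localization.AtPrime.under_maximalIdeal
    have hmax : I.comap (Ideal.Quotient.mk (Module.annihilator L N)) =
        IsLocalRing.maximalIdeal L := by
      have h : (⟨I.comap (Ideal.Quotient.mk (Module.annihilator L N)), inferInstance⟩ :
          PrimeSpectrum L) = ⟨IsLocalRing.maximalIdeal L, inferInstance⟩ := by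
        refine PrimeSpectrum.localization_comap_injective L P.primeCompl (PrimeSpectrum.ext ?_)
        exact hIP.trans Localization.AtPrime.under_maximalIdeal.symm
      exact congrArg PrimeSpectrum.asIdeal h
    have hI' : (I.comap (Ideal.Quotient.mk (Module.annihilator L N))).IsMaximal :=
      hmax ▸ inferInstance
    rw [← Ideal.map_comap_of_surjective _ Ideal.Quotient.mk_surjective I]
    refine (Ideal.map_eq_top_or_isMaximal_of_surjective _ Ideal.Quotient.mk_surjective
      hI').resolve_left ?_
    rw [Ideal.map_comap_of_surjective _ Ideal.Quotient.mk_surjective I]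
    exact hI.ne_top
  let := Module.quotientAnnihilator (R := L) (M := N)
  have : IsScalarTower L (L ⧸ Module.annihilator L N) N :=
    IsScalarTower.of_algebraMap_smul fun _ _ => rfl
  have : Module.Finite (L ⧸ Module.annihilator L N) N :=
    Module.Finite.of_restrictScalars_finite L _ _
  have : IsArtinian L N :=
    isArtinian_of_surjective_algebraMap (R := L ⧸ Module.annihilator L N)
      Ideal.Quotient.mk_surjective
  exact Module.length_ne_top

/-- If `P` is the only point of dimension `i` on the divisor of `x` in `R/Q`, then this divisor is a
positive multiple of `[R/P]`. -/
theorem div_eq_single [IsNoetherianRing R] {i : ℕ} (Q : HomogeneousPrime ℛ (i + 1)) {x : R}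
    (hx : x ∉ Q.1) (P : HomogeneousPrime ℛ i) (hQP : Q.1 ≤ P.1) (hxP : x ∈ P.1)
    (huniq : ∀ P' : HomogeneousPrime ℛ i, Q.1 ≤ P'.1 → x ∈ P'.1 → P' = P) :
    ∃ N : ℕ, N ≠ 0 ∧ div ℛ Q x = Finsupp.single P (N : ℤ) := by
  refine ⟨(localLength P.1 (QuotSMulTop x (R ⧸ Q.1))).toNat, ?_, ?_⟩
  · rw [Ne, ENat.toNat_eq_zero, not_or]
    constructor
    · rw [localLength_eq_zero_iff, not_not, mem_support_quotSMulTop_quotient_iff]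
      exact ⟨hQP, hxP⟩
    · refine localLength_ne_top fun P' hP' hann hle => ?_
      obtain ⟨hQP', hxP'⟩ := mem_support_quotSMulTop_quotient_iff.1
        (Module.mem_support_iff_of_finite.2 hann : (⟨P', hP'⟩ : PrimeSpectrum R) ∈ _)
      have hlt : Q.1 < P' := lt_of_le_of_ne hQP' fun h => hx (h ▸ hxP')
      have : Q.1.IsPrime := Q.2.1
      have h1 := ringKrullDim_quotient_add_one_le_of_lt hlt
      rw [Q.2.2.2] at h1
      refine hle.eq_of_not_lt fun hlt' => ?_
      have h2 := ringKrullDim_quotient_add_one_le_of_lt hlt'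
      rw [P.2.2.2] at h2
      have h3 : ((i + 1 + 1 : ℕ) : WithBot ℕ∞) ≤ (i + 1 : ℕ) := by
        push_cast at h1 ⊢
        exact (add_le_add h2 le_rfl).trans h1
      exact absurd (by exact_mod_cast h3 : i + 1 + 1 ≤ i + 1) (by omega)
  · ext P'
    rw [div_apply ℛ Q x hx]
    by_cases h : P' = P
    · rw [h, Finsupp.single_eq_same]
    · rw [Finsupp.single_eq_of_ne h]
      have : localLength P'.1 (QuotSMulTop x (R ⧸ Q.1)) = 0 := by
        rw [localLength_eq_zero_iff, mem_support_quotSMulTop_quotient_iff]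
        exact fun hP' => h (huniq P' hP'.1 hP'.2)
      rw [this]
      rfl

theorem isAddTorsion_gradedChowGroup {i : ℕ}
    (h : ∀ P : HomogeneousPrime ℛ i, ∃ N : ℕ, N ≠ 0 ∧
      Finsupp.single P (N : ℤ) ∈ rationallyTrivial ℛ i) :
    IsAddTorsion (GradedChowGroup ℛ i) := by
  intro g
  obtain ⟨z, rfl⟩ := QuotientAddGroup.mk_surjective g
  induction z using Finsupp.induction_linear with
  | zero => exact IsOfFinAddOrder.zero
  | add f g hf hg => exact hf.add hg
  | single P a =>
    obtain ⟨N, hN, hP⟩ := h P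
    rw [isOfFinAddOrder_iff_nsmul_eq_zero]
    refine ⟨N, Nat.pos_of_ne_zero hN, ?_⟩
    rw [← QuotientAddGroup.mk_nsmul, QuotientAddGroup.eq_zero_iff]
    have : N • Finsupp.single P a = a • Finsupp.single P (N : ℤ) := by
      simp [mul_comm]
    rw [this]
    exact AddSubgroup.zsmul_mem _ hP a

end Divisor

/-! ### Chow groups of intermediate rings -/

/-- Passing to the homogeneous core does not change a trace on `T` generated by coordinates, since
the coordinates are homogeneous. -/
theorem comap_under_homogeneousCore_eq_flagIdeal {k A : Type*} [Field k] [CommRing A]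
    [Algebra k A] (𝒜 : ℕ → Submodule k A) [GradedAlgebra 𝒜] {n m : ℕ} {T : Subalgebra k A}
    {R : Subalgebra T A} (ℛ : ℕ → AddSubgroup R) [GradedRing ℛ]
    (hR : ∀ (n : ℕ) (r : R), r ∈ ℛ n → (r : A) ∈ 𝒜 n)
    (e : MvPolynomial (Fin (n + 1)) k ≃ₐ[k] T) (he : ∀ i, (e (MvPolynomial.X i) : A) ∈ 𝒜 m)
    {l : ℕ} {Q : Ideal R}
    (hQ : (Q.under T).comap (e : MvPolynomial (Fin (n + 1)) k →+* T) = flagIdeal k (n + 1) l) :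
    ((Q.homogeneousCore ℛ).toIdeal.under T).comap (e : MvPolynomial (Fin (n + 1)) k →+* T) =
      flagIdeal k (n + 1) l := by
  refine le_antisymm ?_ ?_
  · rw [← hQ]
    exact Ideal.comap_mono (Ideal.comap_mono (Ideal.toIdeal_homogeneousCore_le ℛ Q))
  · conv_lhs => rw [flagIdeal]
    rw [Ideal.span_le]
    rintro _ ⟨i, hi, rfl⟩
    refine Ideal.mem_homogeneousCore_of_homogeneous_of_mem
      ⟨m, mem_degree_of_coe_mem 𝒜 ℛ hR (he i)⟩ ?_
    have : MvPolynomial.X i ∈ (Q.under T).comap (e : MvPolynomial (Fin (n + 1)) k →+* T) := by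
      rw [hQ, X_mem_flagIdeal_iff]
      exact hi
    exact this

end GradedChow

theorem theorem1p3 {k A : Type*} [Field k] [IsAlgClosed k] [CommRing A] [Algebra k A]
    -- `A` is a finitely generated graded `k`-algebra with `A_0 = k`
    (𝒜 : ℕ → Submodule k A) [GradedAlgebra 𝒜] (hA0 : 𝒜 0 = 1) (hfin : Algebra.FiniteType k A)
    -- `A` is Cohen-Macaulay of dimension `d ≥ 2`
    (d : ℕ) (hd : 2 ≤ d) (hdim : ringKrullDim A = (d : WithBot ℕ∞))
    (hCM : GradedChow.IsCohenMacaulay A)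
    -- `T = k[X_1, …, X_d]` is a Noether normalization of `A` with all `X_i` of degree `m`
    (m : ℕ) (X : Fin d → A) (T : Subalgebra k A)
    (hT : GradedChow.IsNoetherNormalization 𝒜 m X T)
    -- for every `T`-regular sequence in `T_m` of length `d - 1` there is exactly one prime
    (hass : ∀ u : Fin (d - 1) → T, (∀ i, (u i : A) ∈ 𝒜 m) →
      RingTheory.Sequence.IsRegular T (List.ofFn u) →
      (GradedChow.assOfHeight A (A ⧸ Ideal.span (Set.range fun i => (u i : A)))
        (d - 1)).encard = 1)
    -- `R` is a graded ring with inclusions `T ⊆ R ⊆ A` of graded rings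
    (R : Subalgebra T A) (ℛ : ℕ → AddSubgroup R) [GradedRing ℛ]
    (hR : ∀ (n : ℕ) (r : R), r ∈ ℛ n → (r : A) ∈ 𝒜 n)
    (hgrade : ((d - 1 : ℕ) : ℕ∞) ≤ GradedChow.grade (GradedChow.irrelevant 𝒜 T) R) :
    IsAddTorsion (GradedChow.GradedChowGroup ℛ 1) := by
  open GradedChow in
  obtain ⟨n, rfl⟩ : ∃ n, d = n + 1 + 1 := ⟨d - 2, by omega⟩
  have hfinT : Module.Finite T A := hT.finite
  obtain ⟨e₀, he₀⟩ := hT.exists_algEquiv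
  have hm := degree_pos 𝒜 hA0 (n + 1).succ_pos e₀ he₀
  have hTd : IsDomain T := e₀.symm.toMulEquiv.isDomain
  have hTn : IsNoetherianRing T := isNoetherianRing_of_ringEquiv _ e₀.toRingEquiv
  have hTc : IsIntegrallyClosed T := IsIntegrallyClosed.of_equiv e₀.toRingEquiv
  have hTR : IsNoetherian T R := isNoetherian_submodule' (Subalgebra.toSubmodule R)
  have hRn : IsNoetherianRing R := isNoetherian_of_tower T hTR
  have hAn : IsNoetherianRing A := hCM.1
  have hintR : Algebra.IsIntegral R A := Algebra.IsIntegral.tower_top T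
  have hintTR : Algebra.IsIntegral T R := inferInstance
  have hgd : Algebra.HasGoingDown T A := hasGoingDown_of_minimalPrimes_under_eq_bot T A
    fun P hP => under_eq_bot_of_mem_minimalPrimes 𝒜 hCM hdim hA0 hm e₀ he₀ hP
  refine isAddTorsion_gradedChowGroup ℛ fun P => ?_
  have hPp : P.1.IsPrime := P.2.1
  have hPT : ringKrullDim (T ⧸ P.1.under T) = (1 : ℕ) := by
    rw [← ringKrullDim_quotient_under T, P.2.2.2]
  obtain ⟨e, he, hPe⟩ :=
    exists_coordinates_of_ringKrullDim_quotient_eq_one 𝒜 ℛ hR hA0 hT P.2.2.1 hPT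
  have hlift : ∀ P' : Ideal R, P'.IsPrime → ∃ P'' : Ideal A, P''.IsPrime ∧ P''.under R = P' := by
    intro P' _
    obtain ⟨P'', -, hP'', h⟩ := Ideal.exists_ideal_over_prime_of_isIntegral P' (⊥ : Ideal A) (by
      rw [← RingHom.ker_eq_comap_bot, (RingHom.injective_iff_ker_eq_bot _).1
        (FaithfulSMul.algebraMap_injective R A)]
      exact bot_le)
    exact ⟨P'', hP'', h⟩
  obtain ⟨PA, hPA, hPAR⟩ := hlift P.1 hPp
  have hPAT : PA.under T = P.1.under T := by rw [← hPAR, Ideal.under_under]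
  -- The prime `q` of `T` generated by all but the last of the linear forms generating `P ∩ T`.
  set q : Ideal T := (flagIdeal k (n + 1 + 1) n).comap (e.symm : T →+* _) with hq
  have hqp : q.IsPrime := inferInstance
  have hqe : q.comap (e : MvPolynomial (Fin (n + 1 + 1)) k →+* T) = flagIdeal k (n + 1 + 1) n := by
    ext f
    simp [hq]
  have hqP : q ≤ PA.under T := by
    intro t ht
    have h : e.symm t ∈ flagIdeal k (n + 1 + 1) n := ht
    have h' := (flagIdeal_lt_succ k (Nat.lt_succ_of_lt n.lt_succ_self)).le h
    rw [← hPe, Ideal.mem_comap] at h'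
    rw [hPAT]
    simpa using h'
  have : PA.LiesOver (PA.under T) := ⟨rfl⟩
  -- Going down gives a prime of `A` over `q` inside a prime over `P`; the homogeneous core of its
  -- trace on `R` is the surface on which `P` is cut out, up to multiplicity, by one coordinate.
  obtain ⟨QA, hQPA, hQAp, hQAT⟩ := Ideal.exists_ideal_le_liesOver_of_le PA hqP
  have hQe : ((QA.under R).under T).comap (e : MvPolynomial (Fin (n + 1 + 1)) k →+* T) =
      flagIdeal k (n + 1 + 1) n := by
    rw [Ideal.under_under, ← hQAT.over, hqe]
  have hcoree := comap_under_homogeneousCore_eq_flagIdeal 𝒜 ℛ hR e he hQe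
  set Q₁ : Ideal R := ((QA.under R).homogeneousCore ℛ).toIdeal with hQ₁
  have hQ₁p : Q₁.IsPrime := Ideal.IsPrime.homogeneousCore inferInstance
  have hQ₁P : Q₁ ≤ P.1 :=
    (Ideal.toIdeal_homogeneousCore_le ℛ _).trans ((Ideal.comap_mono hQPA).trans_eq hPAR)
  have hdimflag : ∀ (l : ℕ) (J : Ideal R), (J.under T).comap
      (e : MvPolynomial (Fin (n + 1 + 1)) k →+* T) = flagIdeal k (n + 1 + 1) l →
      ringKrullDim (R ⧸ J) = ringKrullDim (MvPolynomial (Fin (n + 1 + 1)) k ⧸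
        flagIdeal k (n + 1 + 1) l) := by
    intro l J hJ
    rw [ringKrullDim_quotient_under T]
    refine (ringKrullDim_eq_of_ringEquiv (Ideal.quotientEquiv _ _ e.toRingEquiv ?_)).symm
    rw [← hJ]
    exact (Ideal.map_comap_of_surjective _ e.surjective _).symm
  have hQ₁dim : ringKrullDim (R ⧸ Q₁) = (1 + 1 : ℕ) := by
    rw [hdimflag n Q₁ hcoree]
    refine ringKrullDim_quotient_flagIdeal_eq_two k ?_
    rw [← hdimflag (n + 1) P.1 hPe, P.2.2.2]
  let Q : HomogeneousPrime ℛ (1 + 1) := ⟨Q₁, hQ₁p, HomogeneousIdeal.isHomogeneous _, hQ₁dim⟩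
  set i₀ : Fin (n + 1 + 1) := ⟨n, by omega⟩ with hi₀
  set x : R := algebraMap T R (e (MvPolynomial.X i₀)) with hx
  have hmem : ∀ (i : Fin (n + 1 + 1)) (J : Ideal R), algebraMap T R (e (MvPolynomial.X i)) ∈ J ↔
      MvPolynomial.X i ∈ (J.under T).comap (e : MvPolynomial (Fin (n + 1 + 1)) k →+* T) :=
    fun i J => Iff.rfl
  have hxQ : x ∉ Q.1 := by
    rw [hx, hmem, hcoree, X_mem_flagIdeal_iff]
    exact lt_irrefl n
  have hxP : x ∈ P.1 := by
    rw [hx, hmem, hPe, X_mem_flagIdeal_iff]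
    exact n.lt_succ_self
  obtain ⟨N, hN, hdiv⟩ := div_eq_single ℛ Q hxQ P hQ₁P hxP fun P' hQP' hxP' => by
    have hP'p : P'.1.IsPrime := P'.2.1
    obtain ⟨PA', hPA', hPAR'⟩ := hlift P'.1 hP'p
    have hle : P.1.under T ≤ P'.1.under T := by
      intro t ht
      have ht' : e.symm t ∈ flagIdeal k (n + 1 + 1) (n + 1) := by
        rw [← hPe, Ideal.mem_comap]
        simpa using ht
      have hflag : flagIdeal k (n + 1 + 1) (n + 1) ≤
          (P'.1.under T).comap (e : MvPolynomial (Fin (n + 1 + 1)) k →+* T) := by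
        conv_lhs => rw [flagIdeal]
        rw [Ideal.span_le]
        rintro _ ⟨i, hi, rfl⟩
        refine (hmem i P'.1).1 ?_
        rcases Nat.lt_succ_iff_lt_or_eq.1 hi with hi | hi
        · refine hQP' ((hmem i Q₁).2 ?_)
          rw [hcoree, X_mem_flagIdeal_iff]
          exact hi
        · rwa [show i = i₀ from Fin.ext hi]
      have := hflag ht'
      rw [Ideal.mem_comap] at this
      simpa using this
    have hP'T : ringKrullDim (T ⧸ P'.1.under T) = (1 : ℕ) := by
      rw [← ringKrullDim_quotient_under T, P'.2.2.2]
    -- `P'` and `P` have the same trace on `T`, hence the same prime of `A` above them.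
    have heq := eq_of_le_of_ringKrullDim_quotient_eq hle hPT hP'T
    have hPA : PA' = PA := by
      refine eq_of_under_comap_eq_flagIdeal (n := n + 1) hass e he ?_ ?_
      · rw [← Ideal.under_under (B := R), hPAR', ← heq, hPe]
      · rw [hPAT, hPe]
    exact Subtype.ext (by rw [← hPAR', hPA, hPAR])
  refine ⟨N, hN, ?_⟩
  rw [← hdiv]
  exact AddSubgroup.subset_closure
    ⟨Q, x, ⟨m, mem_degree_of_coe_mem 𝒜 ℛ hR (he i₀)⟩, hxQ, rfl⟩
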